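/- Let $\mathbb T$ be the set of isomorphism classes of finite rooted trees. A rooted tree $t$ is a finite connected cycle-free graph with vertex set $V(t)$, edge set $E(t)$ and a distinguished vertex, its root; put $|t| = |V(t)|$. For $e \in E(t)$, let $R_e(t)$ be the connected component of $t - e$ that contains the root of $t$, with the same root, and let $P_e(t)$ be the other component, rooted at the endpoint of $e$ that it contains. For $v \in V(s)$, let $s \cup_v t$ be the tree obtained by joining the root of $t$ to the vertex $v$ of $s$ by one new edge, with the root of $s$ as root. For $t_1, t_2, t_3 \in \mathbb T$ put $$\alpha(t_1,t_2,t_3) = |\{ e \in E(t_2) \mid R_e(t_2) = t_3,\ P_e(t_2) = t_1 \}|, \qquad \beta(t_1,t_2,t_3) = |\{ v \in V(t_3) \mid t_1 = t_3 \cup_v t_2 \}|.$$ The insertion-elimination algebra $\mathfrak g$ is the Lie algebra over $\mathbb C$ with basis $\{d\} \cup \{D_t^{\pm} \mid t \in \mathbb T\}$ and brackets \begin{align*} [D_s^+, D_t^+] &= \sum_{r \in \mathbb T} \left(\beta(r,s,t) - \beta(r,t,s)\right) D_r^+, \\ [D_s^-, D_t^-] &= \sum_{r \in \mathbb T} \left(\alpha(t,r,s)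 - \alpha(s,r,t)\right) D_r^-, \\ [D_s^-, D_t^+] &= \sum_{r \in \mathbb T} \alpha(s,t,r) D_r^+ + \sum_{r \in \mathbb T} \beta(s,t,r) D_r^- \quad (s \neq t), \\ [D_t^-, D_t^+] &= d, \qquad [d, D_t^-] = -|t|\, D_t^-, \qquad [d, D_t^+] = |t|\, D_t^+ . \end{align*} Then every $\mathbb C$-linear derivation $\varphi : \mathfrak g \to \mathfrak g$ is inner, i.e. there is $y \in \mathfrak g$ with $\varphi(x) = [x,y]$ for all $x \in \mathfrak g$; in other words $\mathsf{Der}_{\mathbb C}(\mathfrak g) = \mathsf{Inn}_{\mathbb C}(\mathfrak g)$. Hence the first Lie algebra cohomology $H^1(\mathfrak g, \mathfrak g) \cong \mathsf{Der}_{\mathbb C}(\mathfrak g)/\mathsf{Inn}_{\mathbb C}(\mathfrak g)$ is trivial. -/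

import Mathlib

noncomputable section

namespace InsElim

open SimpleGraph

/-- A (finite) rooted tree: a finite connected cycle-free graph with a distinguished vertex. -/
structure RTree where
  V : Type
  finite : Finite V
  graph : SimpleGraph V
  isTree : graph.IsTree
  root : V

namespace RTree

instance (t : RTree) : Finite t.V := t.finite

/-- The edges of a rooted tree. -/
abbrev E (t : RTree) : Type := t.graph.edgeSet

/-- An isomorphism of rooted trees: a graph isomorphism that maps the root to the root. -/
structure Iso (s t : RTree) where
  toIso : s.graph ≃g t.graph
  map_root : toIso s.root = t.root

namespace Iso

def refl (s : RTree) : Iso s s := ⟨RelIso.refl _, rfl⟩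

def symm {s t : RTree} (f : Iso s t) : Iso t s :=
  ⟨f.toIso.symm, by rw [← f.map_root]; exact f.toIso.symm_apply_apply _⟩

def trans {s t u : RTree} (f : Iso s t) (g : Iso t u) : Iso s u :=
  ⟨f.toIso.trans g.toIso, by
    change g.toIso (f.toIso s.root) = _
    rw [f.map_root, g.map_root]⟩

/-- The action of an isomorphism on edges. -/
def mapE {s t : RTree} (f : Iso s t) : s.E ≃ t.E := f.toIso.mapEdgeSet

end Iso

/-- Two rooted trees are equivalent if they are isomorphic. -/
instance setoid : Setoid RTree where
  r s t := Nonempty (Iso s t)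
  iseqv := ⟨fun s => ⟨Iso.refl s⟩, fun ⟨f⟩ => ⟨f.symm⟩, fun ⟨f⟩ ⟨g⟩ => ⟨f.trans g⟩⟩

/-- The graph on the disjoint union of two graphs, with one additional edge joining them. -/
abbrev joinGraph {V W : Type} (G : SimpleGraph V) (v : V) (H : SimpleGraph W) (w : W) :
    SimpleGraph (V ⊕ W) :=
  (G ⊕g H) ⊔ edge (Sum.inl v) (Sum.inr w)

/-- The edges of the joined graph: the new edge, and the edges of the two graphs. -/
def joinEdge {V W : Type} (G : SimpleGraph V) (v : V) (H : SimpleGraph W) (w : W) :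
    Option (G.edgeSet ⊕ H.edgeSet) → (joinGraph G v H w).edgeSet
  | none => ⟨s(Sum.inl v, Sum.inr w), by
      change (joinGraph G v H w).Adj (Sum.inl v) (Sum.inr w)
      simp [joinGraph, edge_adj]⟩
  | some (Sum.inl e) => ⟨e.1.map Sum.inl, by
      obtain ⟨⟨a, b⟩, h⟩ := e
      change (joinGraph G v H w).Adj (Sum.inl a) (Sum.inl b)
      rw [mem_edgeSet] at h
      simpa [joinGraph, edge_adj] using h⟩
  | some (Sum.inr e) => ⟨e.1.map Sum.inr, by
      obtain ⟨⟨a, b⟩, h⟩ := e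
      change (joinGraph G v H w).Adj (Sum.inr a) (Sum.inr b)
      rw [mem_edgeSet] at h
      simpa [joinGraph, edge_adj] using h⟩

theorem joinEdge_bijective {V W : Type} (G : SimpleGraph V) (v : V) (H : SimpleGraph W) (w : W) :
    Function.Bijective (joinEdge G v H w) := by
  constructor
  · rintro (_ | ⟨⟨⟨a, b⟩, h⟩ | ⟨⟨a, b⟩, h⟩⟩) (_ | ⟨⟨⟨c, d⟩, h'⟩ | ⟨⟨c, d⟩, h'⟩⟩) hh <;>
      simp_all [joinEdge, Sym2.map_mk]
  · rintro ⟨⟨a | a, b | b⟩, h⟩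
    · exact ⟨some (Sum.inl ⟨s(a, b), by
        change (joinGraph G v H w).Adj (Sum.inl a) (Sum.inl b) at h
        simpa [joinGraph, edge_adj] using h⟩), rfl⟩
    · refine ⟨none, ?_⟩
      change (joinGraph G v H w).Adj (Sum.inl a) (Sum.inr b) at h
      simp [joinGraph, edge_adj] at h
      obtain ⟨rfl, rfl⟩ := h
      rfl
    · refine ⟨none, ?_⟩
      change (joinGraph G v H w).Adj (Sum.inr a) (Sum.inl b) at h
      simp [joinGraph, edge_adj] at h
      obtain ⟨rfl, rfl⟩ := h
      exact Subtype.ext Sym2.eq_swap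
    · exact ⟨some (Sum.inr ⟨s(a, b), by
        change (joinGraph G v H w).Adj (Sum.inr a) (Sum.inr b) at h
        simpa [joinGraph, edge_adj] using h⟩), rfl⟩

theorem joinGraph_isTree {V W : Type} [Finite V] [Finite W] {G : SimpleGraph V} (hG : G.IsTree)
    (v : V) {H : SimpleGraph W} (hH : H.IsTree) (w : W) : (joinGraph G v H w).IsTree := by
  rw [isTree_iff_connected_and_card]
  refine ⟨hG.connected.sum_sup_edge hH.connected, ?_⟩
  have h1 := (isTree_iff_connected_and_card.1 hG).2
  have h2 := (isTree_iff_connected_and_card.1 hH).2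
  rw [← Nat.card_congr (Equiv.ofBijective _ (joinEdge_bijective G v H w)), Finite.card_option,
    Nat.card_sum, Nat.card_sum]
  omega

/-- `s.graft v t` is the tree `s ∪ᵥ t`: the root of `t` is joined to the vertex `v` of `s` by a
single new edge, and the root of `s` is the root of the result. -/
abbrev graft (s : RTree) (v : s.V) (t : RTree) : RTree where
  V := s.V ⊕ t.V
  finite := inferInstance
  graph := (s.graph ⊕g t.graph) ⊔ edge (Sum.inl v) (Sum.inr t.root)
  isTree := joinGraph_isTree s.isTree v t.isTree t.root
  root := Sum.inl s.root

/-- The graph obtained from a tree by removing the edge `e`. -/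
abbrev cut (t : RTree) (e : t.E) : SimpleGraph t.V := t.graph.deleteEdges {e.1}

theorem exists_lower (t : RTree) (e : t.E) :
    ∃ w ∈ e.1, ¬ (t.cut e).Reachable t.root w := by
  obtain ⟨⟨v, w⟩, he⟩ := e
  by_contra! h
  have h1 := h v (by simp)
  have h2 := h w (by simp)
  have := isAcyclic_iff_forall_adj_isBridge.1 t.isTree.isAcyclic he
  exact isBridge_iff.1 this (h1.symm.trans h2)

/-- The endpoint of `e` that is cut off from the root when `e` is removed. -/
def lower (t : RTree) (e : t.E) : t.V := (t.exists_lower e).choose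

theorem lower_mem (t : RTree) (e : t.E) : t.lower e ∈ e.1 := (t.exists_lower e).choose_spec.1

theorem not_reachable_lower (t : RTree) (e : t.E) :
    ¬ (t.cut e).Reachable t.root (t.lower e) := (t.exists_lower e).choose_spec.2

theorem cut_isAcyclic (t : RTree) (e : t.E) : (t.cut e).IsAcyclic :=
  t.isTree.isAcyclic.anti (deleteEdges_le _)

/-- The connected component of `v` after removing the edge `e`, as a tree with root `v`. -/
def comp (t : RTree) (e : t.E) (v : t.V) : RTree where
  V := ((t.cut e).connectedComponentMk v).supp
  finite := inferInstance
  graph := (t.cut e).induce ((t.cut e).connectedComponentMk v).supp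
  isTree := (t.cut_isAcyclic e).isTree_connectedComponent _
  root := ⟨v, rfl⟩

/-- `R_e(t)`: the component of `t - e` that contains the root of `t`. -/
def R (t : RTree) (e : t.E) : RTree := t.comp e t.root

/-- `P_e(t)`: the other component of `t - e`, rooted at the endpoint of `e` it contains (its
vertex closest to the root of `t`). -/
def P (t : RTree) (e : t.E) : RTree := t.comp e (t.lower e)

/-- The edge of `s ∪ᵥ t` that joins `s` and `t`. -/
def newEdge (s : RTree) (v : s.V) (t : RTree) : (s.graft v t).E :=
  joinEdge s.graph v t.graph t.root none

theorem exists_reachable_root (t : RTree) (e : t.E) :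
    ∃ v ∈ e.1, (t.cut e).Reachable t.root v := by
  by_contra! h
  have key : ∀ x, t.graph.Reachable t.root x → (t.cut e).Reachable t.root x := by
    intro x hx
    rw [reachable_iff_reflTransGen] at hx
    induction hx with
    | refl => exact Reachable.rfl
    | @tail b c hb hbc ih =>
      refine ih.trans (Adj.reachable ?_)
      rw [deleteEdges_adj]
      refine ⟨hbc, fun hh => h b ?_ ih⟩
      simp only [Set.mem_singleton_iff] at hh
      rw [← hh]; simp
  obtain ⟨w, hw, hw'⟩ := t.exists_lower e
  exact hw' (key w (t.isTree.connected.preconnected _ _))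

theorem exists_edge_eq (t : RTree) (e : t.E) :
    ∃ v, e.1 = s(v, t.lower e) ∧ (t.cut e).Reachable t.root v := by
  obtain ⟨v, hv, hr⟩ := t.exists_reachable_root e
  refine ⟨v, ?_, hr⟩
  have hne : v ≠ t.lower e := by
    rintro rfl; exact t.not_reachable_lower e hr
  exact ((Sym2.mem_and_mem_iff hne).1 ⟨hv, t.lower_mem e⟩)

theorem reachable_or (t : RTree) (e : t.E) (x : t.V) :
    (t.cut e).Reachable t.root x ∨ (t.cut e).Reachable (t.lower e) x := by
  obtain ⟨v, he, hr⟩ := t.exists_edge_eq e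
  have hx := t.isTree.connected.preconnected t.root x
  rw [reachable_iff_reflTransGen] at hx
  induction hx with
  | refl => exact Or.inl Reachable.rfl
  | @tail b c hb hbc ih =>
    by_cases h : s(b, c) = e.1
    · rw [he, Sym2.eq_iff] at h
      rcases h with ⟨-, rfl⟩ | ⟨-, rfl⟩
      · exact Or.inr Reachable.rfl
      · exact Or.inl hr
    · have : (t.cut e).Adj b c := by
        rw [deleteEdges_adj]; exact ⟨hbc, h⟩
      exact ih.imp (·.trans this.reachable) (·.trans this.reachable)

/-- A tree is recovered by grafting the two pieces cut at an edge. -/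
theorem exists_decomp (t : RTree) (e : t.E) :
    ∃ (v : (t.R e).V) (f : Iso ((t.R e).graft v (t.P e)) t), f.mapE (newEdge _ v _) = e := by
  obtain ⟨v, he, hr⟩ := t.exists_edge_eq e
  have hR : ∀ x, x ∈ ((t.cut e).connectedComponentMk t.root).supp ↔
      (t.cut e).Reachable t.root x := fun x => by
    rw [ConnectedComponent.mem_supp_iff, ConnectedComponent.eq, reachable_comm]
  have hP : ∀ x, x ∈ ((t.cut e).connectedComponentMk (t.lower e)).supp ↔
      (t.cut e).Reachable (t.lower e) x := fun x => by
    rw [ConnectedComponent.mem_supp_iff, ConnectedComponent.eq, reachable_comm]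
  let v' : (t.R e).V := ⟨v, (hR v).2 hr⟩
  let g : (t.R e).V ⊕ (t.P e).V → t.V := Sum.elim (fun x => x.1) (fun x => x.1)
  have disj : ∀ (x : (t.R e).V) (y : (t.P e).V), ¬ (t.cut e).Reachable x.1 y.1 := by
    intro x y h
    exact t.not_reachable_lower e
      ((((hR _).1 x.2).trans h).trans ((hP _).1 y.2).symm)
  have hg : Function.Bijective g := by
    constructor
    · rintro (x | x) (y | y) h
      · exact congrArg _ (Subtype.ext h)
      · exact (disj x y (by change x.1 = y.1 at h; rw [h])).elim
      · exact (disj y x (by change x.1 = y.1 at h; rw [h])).elim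
      · exact congrArg _ (Subtype.ext h)
    · intro x
      rcases t.reachable_or e x with h | h
      · exact ⟨Sum.inl ⟨x, (hR x).2 h⟩, rfl⟩
      · exact ⟨Sum.inr ⟨x, (hP x).2 h⟩, rfl⟩
  have hmem : t.graph.Adj v (t.lower e) := by
    have := e.2; rwa [he] at this
  have hcut : ∀ a b, (t.cut e).Adj a b ↔ t.graph.Adj a b ∧ s(a, b) ≠ s(v, t.lower e) := by
    intro a b; rw [deleteEdges_adj, Set.mem_singleton_iff, he]
  have hadj : ∀ a b, t.graph.Adj (g a) (g b) ↔ ((t.R e).graft v' (t.P e)).graph.Adj a b := by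
    have cross : ∀ (x : (t.R e).V) (y : (t.P e).V), t.graph.Adj x.1 y.1 ↔
        (x = v' ∧ y = (t.P e).root) := by
      intro x y
      constructor
      · intro h
        by_contra hne
        refine disj x y (Adj.reachable ((hcut _ _).2 ⟨h, fun h' => ?_⟩))
        rw [Sym2.eq_iff] at h'
        rcases h' with ⟨h1, h2⟩ | ⟨h1, h2⟩
        · exact hne ⟨Subtype.ext h1, Subtype.ext h2⟩
        · exact t.not_reachable_lower e (h1 ▸ (hR _).1 x.2)
      · rintro ⟨rfl, rfl⟩; exact hmem
    have inl : ∀ (x y : (t.R e).V), t.graph.Adj x.1 y.1 ↔ (t.R e).graph.Adj x y := by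
      intro x y
      change _ ↔ (t.cut e).Adj x.1 y.1
      rw [hcut]
      refine ⟨fun h => ⟨h, fun h' => ?_⟩, And.left⟩
      rw [Sym2.eq_iff] at h'
      rcases h' with ⟨h1, h2⟩ | ⟨h1, h2⟩
      · exact t.not_reachable_lower e (h2 ▸ (hR _).1 y.2)
      · exact t.not_reachable_lower e (h1 ▸ (hR _).1 x.2)
    have inr : ∀ (x y : (t.P e).V), t.graph.Adj x.1 y.1 ↔ (t.P e).graph.Adj x y := by
      intro x y
      change _ ↔ (t.cut e).Adj x.1 y.1
      rw [hcut]
      refine ⟨fun h => ⟨h, fun h' => ?_⟩, And.left⟩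
      rw [Sym2.eq_iff] at h'
      rcases h' with ⟨h1, h2⟩ | ⟨h1, h2⟩
      · exact disj v' x (h1 ▸ Reachable.rfl)
      · exact disj v' y (h2 ▸ Reachable.rfl)
    rintro (x | x) (y | y)
    · simpa [graft, edge_adj, g] using inl x y
    · simpa [graft, edge_adj, g] using cross x y
    · rw [adj_comm]
      simpa [graft, edge_adj, g, and_comm] using cross y x
    · simpa [graft, edge_adj, g] using inr x y
  refine ⟨v', ⟨⟨Equiv.ofBijective g hg, fun {a b} => hadj a b⟩, rfl⟩, ?_⟩
  apply Subtype.ext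
  rw [he]
  rfl

/-- The pieces cut at the new edge of a graft. -/
theorem pieces (s : RTree) (v : s.V) (r t : RTree) (f : Iso (s.graft v r) t) (e : t.E)
    (he : f.mapE (newEdge s v r) = e) : t.R e ≈ s ∧ t.P e ≈ r := by
  have he1 : e.1 = s(f.toIso (Sum.inl v), f.toIso (Sum.inr r.root)) := by rw [← he]; rfl
  let ψ : (s.graph ⊕g r.graph) ≃g t.cut e := ⟨f.toIso.toEquiv, by
    intro a b
    rw [deleteEdges_adj, Set.mem_singleton_iff, he1]
    have h1 : t.graph.Adj (f.toIso.toEquiv a) (f.toIso.toEquiv b) ↔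
      (s.graft v r).graph.Adj a b := f.toIso.map_rel_iff
    have inj := f.toIso.toEquiv.injective
    rw [h1, Sym2.eq_iff]
    have h2 : ∀ a b, f.toIso.toEquiv a = f.toIso b ↔ a = b := fun a b => inj.eq_iff
    rw [h2, h2, h2, h2]
    rcases a with a | a <;> rcases b with b | b <;> simp [graft, edge_adj]⟩
  have hψ : ∀ x, ψ x = f.toIso x := fun _ => rfl
  have nr : ∀ a b, ¬ (t.cut e).Reachable (ψ (Sum.inl a)) (ψ (Sum.inr b)) := by
    intro a b h
    rw [Iso.reachable_iff] at h
    exact not_reachable_sum_inl_inr _ _ h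
  have hroot : t.root = ψ (Sum.inl s.root) := f.map_root.symm
  have rl : ∀ a b, (t.cut e).Reachable (ψ (Sum.inl a)) (ψ (Sum.inl b)) := by
    intro a b
    rw [Iso.reachable_iff]
    exact (s.isTree.connected.preconnected a b).map Embedding.sumInl.toHom
  have rr : ∀ a b, (t.cut e).Reachable (ψ (Sum.inr a)) (ψ (Sum.inr b)) := by
    intro a b
    rw [Iso.reachable_iff]
    exact (r.isTree.connected.preconnected a b).map Embedding.sumInr.toHom
  have hlow : t.lower e = ψ (Sum.inr r.root) := by
    have h1 := t.lower_mem e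
    rw [he1, Sym2.mem_iff] at h1
    rcases h1 with h1 | h1
    · exact (t.not_reachable_lower e (by rw [hroot, h1]; exact rl _ _)).elim
    · exact h1
  constructor
  · refine Setoid.symm ⟨⟨⟨Equiv.ofBijective (fun x => ⟨ψ (Sum.inl x), ?_⟩) ⟨?_, ?_⟩, ?_⟩, ?_⟩⟩
    · rw [ConnectedComponent.mem_supp_iff, ConnectedComponent.eq, hroot]; exact rl _ _
    · intro x y h
      exact Sum.inl_injective (ψ.injective (congrArg Subtype.val h))
    · rintro ⟨y, hy⟩
      rw [ConnectedComponent.mem_supp_iff, ConnectedComponent.eq, hroot] at hy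
      obtain ⟨x | x, rfl⟩ := ψ.surjective y
      · exact ⟨x, rfl⟩
      · exact (nr _ _ hy.symm).elim
    · intro a b
      change (t.cut e).Adj (ψ (Sum.inl a)) (ψ (Sum.inl b)) ↔ _
      rw [ψ.map_adj_iff]; simp
    · exact Subtype.ext hroot.symm
  · refine Setoid.symm ⟨⟨⟨Equiv.ofBijective (fun x => ⟨ψ (Sum.inr x), ?_⟩) ⟨?_, ?_⟩, ?_⟩, ?_⟩⟩
    · rw [ConnectedComponent.mem_supp_iff, ConnectedComponent.eq, hlow]; exact rr _ _
    · intro x y h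
      exact Sum.inr_injective (ψ.injective (congrArg Subtype.val h))
    · rintro ⟨y, hy⟩
      rw [ConnectedComponent.mem_supp_iff, ConnectedComponent.eq, hlow] at hy
      obtain ⟨x | x, rfl⟩ := ψ.surjective y
      · exact (nr _ _ hy).elim
      · exact ⟨x, rfl⟩
    · intro a b
      change (t.cut e).Adj (ψ (Sum.inr a)) (ψ (Sum.inr b)) ↔ _
      rw [ψ.map_adj_iff]; simp
    · exact Subtype.ext hlow.symm

/-- Grafting respects isomorphisms. -/
def graftIso {s s' t t' : RTree} (f : Iso s s') (g : Iso t t') (v : s.V) :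
    Iso (s.graft v t) (s'.graft (f.toIso v) t') where
  toIso := ⟨Equiv.sumCongr f.toIso.toEquiv g.toIso.toEquiv, by
    have hf : ∀ a b, f.toIso a = f.toIso b ↔ a = b := fun a b => f.toIso.injective.eq_iff
    have hg : ∀ a, g.toIso a = t'.root ↔ a = t.root := fun a => by
      rw [← g.map_root]; exact g.toIso.injective.eq_iff
    rintro (a | a) (b | b) <;> simp [graft, edge_adj, hf, hg, SimpleGraph.Iso.map_adj_iff]⟩
  map_root := congrArg Sum.inl f.map_root

/-- Two grafts on the same tree commute. -/
def graftComm (a : RTree) (v w : a.V) (b c : RTree) :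
    Iso ((a.graft v b).graft (Sum.inl w) c) ((a.graft w c).graft (Sum.inl v) b) where
  toIso := ⟨⟨Sum.elim (Sum.elim (Sum.inl ∘ Sum.inl) Sum.inr) (Sum.inl ∘ Sum.inr),
      Sum.elim (Sum.elim (Sum.inl ∘ Sum.inl) Sum.inr) (Sum.inl ∘ Sum.inr),
      by rintro ((x | x) | x) <;> rfl, by rintro ((x | x) | x) <;> rfl⟩, by
    rintro ((x | x) | x) ((y | y) | y) <;> simp [graft, edge_adj]⟩
  map_root := rfl

/-- Iterated grafts are associative. -/
def graftAssoc (a : RTree) (v : a.V) (b : RTree) (w : b.V) (c : RTree) :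
    Iso ((a.graft v b).graft (Sum.inr w) c) (a.graft v (b.graft w c)) where
  toIso := ⟨Equiv.sumAssoc _ _ _, by
    rintro ((x | x) | x) ((y | y) | y) <;> simp [graft, edge_adj]⟩
  map_root := rfl

theorem R_mapE {s t : RTree} (f : Iso s t) (e : s.E) : t.R (f.mapE e) ≈ s.R e := by
  obtain ⟨v, g, hg⟩ := s.exists_decomp e
  refine (pieces _ v _ t (g.trans f) _ ?_).1
  refine Eq.trans ?_ (congrArg f.mapE hg)
  rfl

theorem P_mapE {s t : RTree} (f : Iso s t) (e : s.E) : t.P (f.mapE e) ≈ s.P e := by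
  obtain ⟨v, g, hg⟩ := s.exists_decomp e
  refine (pieces _ v _ t (g.trans f) _ ?_).2
  refine Eq.trans ?_ (congrArg f.mapE hg)
  rfl

/-- The one-vertex tree. -/
def bullet : RTree where
  V := Unit
  finite := inferInstance
  graph := ⊥
  isTree := IsTree.of_subsingleton
  root := ()

end RTree

/-- The set of isomorphism classes of rooted trees. -/
def Tree : Type 1 := Quotient RTree.setoid

/-- The isomorphism class of a rooted tree. -/
def cls (t : RTree) : Tree := Quotient.mk _ t

theorem cls_eq {s t : RTree} : cls s = cls t ↔ s ≈ t := Quotient.eq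

namespace Tree

/-- The number of vertices. -/
def size : Tree → ℕ :=
  Quotient.lift (fun t => Nat.card t.V) (fun s t (h : Nonempty (RTree.Iso s t)) =>
    h.elim fun f => Nat.card_congr f.toIso.toEquiv)

/-- `α(t₁, t₂, t₃)` is the number of edges `e` of `t₂` with `R_e(t₂) = t₃` and `P_e(t₂) = t₁`. -/
def alpha (t₁ t₂ t₃ : Tree) : ℕ :=
  Quotient.lift (fun t : RTree => Nat.card {e : t.E // cls (t.R e) = t₃ ∧ cls (t.P e) = t₁})
    (fun s t (h : Nonempty (RTree.Iso s t)) => h.elim fun f => Nat.card_congr (f.mapE.subtypeEquiv fun e => by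
      rw [cls_eq.2 (RTree.R_mapE f e), cls_eq.2 (RTree.P_mapE f e)])) t₂

/-- `β(t₁, t₂, t₃)` is the number of vertices `v` of `t₃` with `t₁ = t₃ ∪ᵥ t₂`. -/
def beta (t₁ t₂ t₃ : Tree) : ℕ :=
  Quotient.lift₂ (fun s t : RTree => Nat.card {v : t.V // t₁ = cls (t.graft v s)})
    (fun s t s' t' (h : Nonempty (RTree.Iso s s')) (h' : Nonempty (RTree.Iso t t')) =>
      h.elim fun f => h'.elim fun g => Nat.card_congr (g.toIso.toEquiv.subtypeEquiv fun v => by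
      rw [cls_eq.2 ⟨RTree.graftIso g f v⟩]; rfl)) t₂ t₃

theorem beta_finite (s t : Tree) : {r | beta r s t ≠ 0}.Finite := by
  induction s using Quotient.inductionOn with | _ s
  induction t using Quotient.inductionOn with | _ t
  refine (Set.finite_range fun v : t.V => cls (t.graft v s)).subset fun r hr => ?_
  obtain ⟨⟨v, hv⟩, -⟩ := Nat.card_ne_zero.1 hr
  exact ⟨v, hv.symm⟩

theorem alpha_finite (s t : Tree) : {r | alpha s t r ≠ 0}.Finite := by
  induction t using Quotient.inductionOn with | _ t
  refine (Set.finite_range fun e : t.E => cls (t.R e)).subset fun r hr => ?_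
  obtain ⟨⟨e, he, -⟩, -⟩ := Nat.card_ne_zero.1 hr
  exact ⟨e, he⟩

theorem alpha_ne_zero_iff (s t r : Tree) : alpha s t r ≠ 0 ↔ beta t s r ≠ 0 := by
  induction t using Quotient.inductionOn with | _ t
  induction s using Quotient.inductionOn with | _ s
  induction r using Quotient.inductionOn with | _ r
  constructor
  · intro h
    obtain ⟨⟨e, h1, h2⟩, -⟩ := Nat.card_ne_zero.1 h
    obtain ⟨v, f, -⟩ := t.exists_decomp e
    obtain ⟨g⟩ := cls_eq.1 h1
    obtain ⟨k⟩ := cls_eq.1 h2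
    exact Nat.card_ne_zero.2 ⟨⟨⟨g.toIso v,
      cls_eq.2 ⟨f.symm.trans (RTree.graftIso g k v)⟩⟩⟩, inferInstance⟩
  · intro h
    obtain ⟨⟨v, h1⟩, -⟩ := Nat.card_ne_zero.1 h
    obtain ⟨f⟩ := cls_eq.1 h1
    obtain ⟨h2, h3⟩ := RTree.pieces r v s t f.symm _ rfl
    exact Nat.card_ne_zero.2 ⟨⟨⟨_, cls_eq.2 h2, cls_eq.2 h3⟩⟩, inferInstance⟩

theorem alpha_finite_mid (s r : Tree) : {t | alpha s t r ≠ 0}.Finite := by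
  simp only [alpha_ne_zero_iff]
  exact beta_finite s r

theorem beta_finite_right (t s : Tree) : {r | beta t s r ≠ 0}.Finite := by
  simp only [← alpha_ne_zero_iff]
  exact alpha_finite s t

/-- The one-vertex tree. -/
def bullet : Tree := cls RTree.bullet

/-- The root of `b` is joined to the root of `a`. -/
def join (a b : Tree) : Tree :=
  Quotient.map₂ (fun s t : RTree => s.graft s.root t)
    (fun s s' (h : Nonempty (RTree.Iso s s')) t t' (h' : Nonempty (RTree.Iso t t')) => by
      obtain ⟨f⟩ := h
      obtain ⟨g⟩ := h'
      have := RTree.graftIso f g s.root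
      rw [f.map_root] at this
      exact ⟨this⟩) a b

theorem join_cls (a b : RTree) : join (cls a) (cls b) = cls (a.graft a.root b) := rfl

theorem join_comm (a b c : Tree) : join (join a b) c = join (join a c) b := by
  induction a using Quotient.inductionOn with | _ a
  induction b using Quotient.inductionOn with | _ b
  induction c using Quotient.inductionOn with | _ c
  exact cls_eq.2 ⟨RTree.graftComm a a.root a.root b c⟩

theorem size_bullet : size bullet = 1 := by
  change Nat.card Unit = 1
  simp

theorem size_join (a b : Tree) : size (join a b) = size a + size b := by
  induction a using Quotient.inductionOn with | _ a
  induction b using Quotient.inductionOn with | _ b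
  change Nat.card (a.V ⊕ b.V) = _
  rw [Nat.card_sum]
  rfl

theorem size_pos (a : Tree) : 0 < size a := by
  induction a using Quotient.inductionOn with | _ a
  have : Nonempty a.V := ⟨a.root⟩
  exact Nat.card_pos

theorem join_ne_bullet (a b : Tree) : join a b ≠ bullet := by
  intro h
  have := congrArg size h
  rw [size_join, size_bullet] at this
  have := size_pos a
  have := size_pos b
  omega

theorem eq_bullet_or_join (t : Tree) : t = bullet ∨ ∃ a b, t = join a b := by
  induction t using Quotient.inductionOn with | _ t
  by_cases h : ∃ w, t.graph.Adj t.root w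
  · right
    obtain ⟨w, hw⟩ := h
    obtain ⟨v, f, hf⟩ := t.exists_decomp ⟨s(t.root, w), hw⟩
    refine ⟨cls (t.R ⟨s(t.root, w), hw⟩), cls (t.P ⟨s(t.root, w), hw⟩), ?_⟩
    have h1 : s(f.toIso (Sum.inl v), f.toIso (Sum.inr (t.P ⟨s(t.root, w), hw⟩).root)) =
      s(t.root, w) := congrArg Subtype.val hf
    have h2 : f.toIso (Sum.inl (t.R ⟨s(t.root, w), hw⟩).root) = t.root := f.map_root
    rw [Sym2.eq_iff] at h1
    have h3 : v = (t.R ⟨s(t.root, w), hw⟩).root := by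
      rcases h1 with h1 | h1
      · exact Sum.inl_injective (f.toIso.injective (h1.1.trans h2.symm))
      · exact absurd (f.toIso.injective (h1.2.trans h2.symm)) (by simp)
    rw [join_cls, ← h3]
    exact cls_eq.2 ⟨f.symm⟩
  · left
    push Not at h
    have key : ∀ x, x = t.root := by
      intro x
      have hx := t.isTree.connected.preconnected t.root x
      rw [reachable_iff_reflTransGen] at hx
      induction hx with
      | refl => rfl
      | tail hb hbc ih => exact absurd (ih ▸ hbc) (h _)
    refine cls_eq.2 ⟨⟨⟨⟨fun _ => (), fun _ => t.root, fun x => (key x).symm, fun _ => rfl⟩, ?_⟩,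
      rfl⟩⟩
    intro a b
    rw [key a, key b]
    simp

theorem induction {p : Tree → Prop} (h1 : p bullet) (h2 : ∀ a b, p a → p b → p (join a b))
    (t : Tree) : p t := by
  induction hn : size t using Nat.strong_induction_on generalizing t with
  | _ n ih =>
    rcases eq_bullet_or_join t with rfl | ⟨a, b, rfl⟩
    · exact h1
    · rw [size_join] at hn
      have := size_pos a
      have := size_pos b
      exact h2 a b (ih _ (by omega) a rfl) (ih _ (by omega) b rfl)

end Tree

namespace RTree

theorem pieces_none (a b : RTree) :
    (a.graft a.root b).R (joinEdge a.graph a.root b.graph b.root none) ≈ a ∧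
    (a.graft a.root b).P (joinEdge a.graph a.root b.graph b.root none) ≈ b :=
  pieces a a.root b _ (Iso.refl _) _ (Subtype.ext rfl)

theorem pieces_inl (a b : RTree) (e : a.E) :
    (a.graft a.root b).R (joinEdge a.graph a.root b.graph b.root (some (Sum.inl e))) ≈
      (a.R e).graft (a.R e).root b ∧
    (a.graft a.root b).P (joinEdge a.graph a.root b.graph b.root (some (Sum.inl e))) ≈
      a.P e := by
  obtain ⟨v, f, hf⟩ := a.exists_decomp e
  have hr : f.toIso (Sum.inl (a.R e).root) = a.root := f.map_root
  have key : ∀ x, f.toIso (Sum.inl (a.R e).root) = x →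
      ∃ k : Iso (((a.R e).graft v (a.P e)).graft (Sum.inl (a.R e).root) b) (a.graft x b),
        ∀ y, k.toIso (Sum.inl y) = Sum.inl (f.toIso y) := by
    rintro x rfl
    exact ⟨graftIso f (Iso.refl b) (Sum.inl (a.R e).root), fun _ => rfl⟩
  obtain ⟨k, hk⟩ := key _ hr
  refine pieces _ (Sum.inl v) _ _ ((graftComm (a.R e) (a.R e).root v b (a.P e)).trans k) _ ?_
  apply Subtype.ext
  have h1 : s(f.toIso (Sum.inl v), f.toIso (Sum.inr (a.P e).root)) = e.1 :=
    congrArg Subtype.val hf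
  change s(k.toIso (Sum.inl (Sum.inl v)), k.toIso (Sum.inl (Sum.inr (a.P e).root))) =
    e.1.map Sum.inl
  rw [hk, hk, ← h1]
  rfl

theorem pieces_inr (a b : RTree) (e : b.E) :
    (a.graft a.root b).R (joinEdge a.graph a.root b.graph b.root (some (Sum.inr e))) ≈
      a.graft a.root (b.R e) ∧
    (a.graft a.root b).P (joinEdge a.graph a.root b.graph b.root (some (Sum.inr e))) ≈
      b.P e := by
  obtain ⟨v, f, hf⟩ := b.exists_decomp e
  refine pieces _ (Sum.inr v) _ _ ((graftAssoc a a.root (b.R e) v (b.P e)).trans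
    (graftIso (Iso.refl a) f a.root)) _ ?_
  apply Subtype.ext
  have h1 : s(f.toIso (Sum.inl v), f.toIso (Sum.inr (b.P e).root)) = e.1 :=
    congrArg Subtype.val hf
  change s(Sum.inr (f.toIso (Sum.inl v)), Sum.inr (f.toIso (Sum.inr (b.P e).root))) =
    e.1.map Sum.inr
  rw [← h1]
  rfl

end RTree


/-- The vector space spanned by the rooted trees, on which the algebra acts. -/
abbrev F : Type 1 := Tree →₀ ℂ

namespace F

open InsElim.Tree

/-- A tree as a vector. -/
def tr (t : Tree) : F := Finsupp.single t 1

open scoped Classical in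
theorem tr_apply (s t : Tree) : tr s t = if s = t then 1 else 0 := Finsupp.single_apply

/-- The bilinear extension of `Tree.join`. -/
def mul : F →ₗ[ℂ] F →ₗ[ℂ] F :=
  Finsupp.linearCombination ℂ fun a => Finsupp.linearCombination ℂ fun b => tr (join a b)

theorem mul_tr (a b : Tree) : mul (tr a) (tr b) = tr (join a b) := by
  simp [mul, tr]

theorem mul_comm' (x : F) (b c : Tree) :
    mul (mul x (tr b)) (tr c) = mul (mul x (tr c)) (tr b) := by
  induction x using Finsupp.induction_linear with
  | zero => simp
  | add x y hx hy => simp [hx, hy]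
  | single a r =>
    have : (Finsupp.single a r : F) = r • tr a := by simp [tr]
    rw [this]
    simp only [map_smul, LinearMap.smul_apply, mul_tr, join_comm]

theorem mul_apply_bullet (x y : F) : mul x y bullet = 0 := by
  induction x using Finsupp.induction_linear with
  | zero => simp
  | add x y hx hy => simp [hx, hy]
  | single a r =>
    induction y using Finsupp.induction_linear with
    | zero => simp
    | add x y hx hy => rw [map_add, Finsupp.add_apply, hx, hy, add_zero]
    | single b q => simp [mul, tr, join_ne_bullet]

theorem ext_tr {M : Type*} [AddCommMonoid M] [Module ℂ M] {f g : F →ₗ[ℂ] M}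
    (h : ∀ t, f (tr t) = g (tr t)) : f = g :=
  Finsupp.lhom_ext' fun t => LinearMap.ext_ring (h t)

/-- `∑ᵣ β(r, s, t) r`. -/
def attach (s t : Tree) : F :=
  Finsupp.ofSupportFinite (fun r => (beta r s t : ℂ))
    ((beta_finite s t).subset fun r hr => by simpa using hr)

/-- `∑ᵣ α(s, t, r) r`. -/
def detach (s t : Tree) : F :=
  Finsupp.ofSupportFinite (fun r => (alpha s t r : ℂ))
    ((alpha_finite s t).subset fun r hr => by simpa using hr)

open scoped Classical in
theorem attach_cls (s t : RTree) [Fintype t.V] :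
    attach (cls s) (cls t) = ∑ v : t.V, tr (cls (t.graft v s)) := by
  ext r
  rw [Finsupp.finsetSum_apply]
  change ((Nat.card {v : t.V // r = cls (t.graft v s)} : ℕ) : ℂ) = _
  simp only [tr, Finsupp.single_apply]
  rw [Finset.sum_boole, Nat.card_eq_fintype_card, Fintype.card_subtype]
  simp only [eq_comm]

open scoped Classical in
theorem detach_cls (s : Tree) (t : RTree) [Fintype t.E] :
    detach s (cls t) = ∑ e : t.E, if cls (t.P e) = s then tr (cls (t.R e)) else 0 := by
  ext r
  rw [Finsupp.finsetSum_apply]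
  change ((Nat.card {e : t.E // cls (t.R e) = r ∧ cls (t.P e) = s} : ℕ) : ℂ) = _
  have : ∀ e : t.E, (if cls (t.P e) = s then tr (cls (t.R e)) else 0 : F) r =
      if cls (t.R e) = r ∧ cls (t.P e) = s then 1 else 0 := by
    intro e
    by_cases h : cls (t.P e) = s <;> simp [h, tr, Finsupp.single_apply]
  simp only [this]
  rw [Finset.sum_boole, Nat.card_eq_fintype_card, Fintype.card_subtype]

theorem attach_bullet (s : Tree) : attach s bullet = tr (join bullet s) := by
  induction s using Quotient.inductionOn with | _ s
  let _ : Unique RTree.bullet.V := inferInstanceAs (Unique Unit)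
  refine (attach_cls s RTree.bullet).trans ?_
  rw [Fintype.sum_unique]
  rfl

theorem attach_join (s a b : Tree) :
    attach s (join a b) = mul (attach s a) (tr b) + mul (tr a) (attach s b) := by
  induction s using Quotient.inductionOn with | _ s
  induction a using Quotient.inductionOn with | _ a
  induction b using Quotient.inductionOn with | _ b
  have := Fintype.ofFinite a.V
  have := Fintype.ofFinite b.V
  refine (attach_cls s (a.graft a.root b)).trans ?_
  change _ = mul (attach (cls s) (cls a)) (tr (cls b)) + mul (tr (cls a)) (attach (cls s) (cls b))
  rw [attach_cls s a, attach_cls s b, Fintype.sum_sum_type, map_sum, map_sum, LinearMap.sum_apply]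
  simp only [mul_tr, join_cls]
  congr 1
  · refine Finset.sum_congr rfl fun v _ => congrArg tr ?_
    exact cls_eq.2 ⟨RTree.graftComm a a.root v b s⟩
  · refine Finset.sum_congr rfl fun v _ => congrArg tr ?_
    exact cls_eq.2 ⟨RTree.graftAssoc a a.root b v s⟩

theorem detach_bullet (s : Tree) : detach s bullet = 0 := by
  have : IsEmpty RTree.bullet.E := by
    refine ⟨fun e => ?_⟩
    have h : e.1 ∈ (⊥ : SimpleGraph Unit).edgeSet := e.2
    rw [SimpleGraph.edgeSet_bot] at h
    exact h
  have := Fintype.ofFinite RTree.bullet.E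
  refine (detach_cls s RTree.bullet).trans ?_
  exact Finset.sum_eq_zero fun e _ => isEmptyElim e

open scoped Classical in
theorem detach_join (s a b : Tree) :
    detach s (join a b) = mul (detach s a) (tr b) + mul (tr a) (detach s b) +
      if b = s then tr a else 0 := by
  induction a using Quotient.inductionOn with | _ a
  induction b using Quotient.inductionOn with | _ b
  have := Fintype.ofFinite a.E
  have := Fintype.ofFinite b.E
  have := Fintype.ofFinite (a.graft a.root b).E
  refine (detach_cls s (a.graft a.root b)).trans ?_
  change _ = mul (detach s (cls a)) (tr (cls b)) + mul (tr (cls a)) (detach s (cls b)) +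
    if cls b = s then tr (cls a) else 0
  rw [detach_cls s a, detach_cls s b, map_sum, map_sum, LinearMap.sum_apply]
  rw [← Equiv.sum_comp (Equiv.ofBijective _
    (RTree.joinEdge_bijective a.graph a.root b.graph b.root)), Fintype.sum_option,
    Fintype.sum_sum_type, add_comm]
  simp only [Equiv.ofBijective_apply]
  congr 1
  · congr 1
    · refine Finset.sum_congr rfl fun e _ => ?_
      obtain ⟨h1, h2⟩ := RTree.pieces_inl a b e
      rw [cls_eq.2 h1, cls_eq.2 h2, ← join_cls]
      split_ifs <;> simp [mul_tr]
    · refine Finset.sum_congr rfl fun e _ => ?_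
      obtain ⟨h1, h2⟩ := RTree.pieces_inr a b e
      rw [cls_eq.2 h1, cls_eq.2 h2, ← join_cls]
      split_ifs <;> simp [mul_tr]
  · obtain ⟨h1, h2⟩ := RTree.pieces_none a b
    rw [cls_eq.2 h1, cls_eq.2 h2]

/-- Insertion of `s`. -/
def ins (s : Tree) : F →ₗ[ℂ] F := Finsupp.linearCombination ℂ (attach s)

/-- Elimination of `s`. -/
def elim (s : Tree) : F →ₗ[ℂ] F := Finsupp.linearCombination ℂ (detach s)

/-- Multiplication by the number of vertices. -/
def deg : F →ₗ[ℂ] F := Finsupp.linearCombination ℂ fun t => (size t : ℂ) • tr t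

theorem ins_tr (s t : Tree) : ins s (tr t) = attach s t := by simp [ins, tr]

theorem elim_tr (s t : Tree) : elim s (tr t) = detach s t := by simp [elim, tr]

theorem deg_tr (t : Tree) : deg (tr t) = (size t : ℂ) • tr t := by simp [deg, tr]

/-- The derivations of the bilinear product. -/
def IsDer (X : F →ₗ[ℂ] F) : Prop := ∀ x y, X (mul x y) = mul (X x) y + mul x (X y)

theorem isDer_of_tr {X : F →ₗ[ℂ] F}
    (h : ∀ a b, X (tr (join a b)) = mul (X (tr a)) (tr b) + mul (tr a) (X (tr b))) :
    IsDer X := by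
  have : (LinearMap.compr₂ mul X) = (mul ∘ₗ X) + (mul.compl₂ X) := by
    refine ext_tr fun a => ext_tr fun b => ?_
    simpa [mul_tr] using h a b
  intro x y
  exact congrArg (fun f => f x y) this

theorem ins_isDer (s : Tree) : IsDer (ins s) :=
  isDer_of_tr fun a b => by rw [ins_tr, ins_tr, ins_tr, attach_join]

theorem deg_isDer : IsDer deg :=
  isDer_of_tr fun a b => by
    simp only [deg_tr, size_join, map_smul, LinearMap.smul_apply, mul_tr, Nat.cast_add, add_smul]

theorem elim_mul (s : Tree) (x y : F) :
    elim s (mul x y) = mul (elim s x) y + mul x (elim s y) + y s • x := by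
  have : (LinearMap.compr₂ mul (elim s)) = (mul ∘ₗ elim s) + (mul.compl₂ (elim s)) +
      (LinearMap.lsmul ℂ F ∘ₗ Finsupp.lapply s).flip := by
    refine ext_tr fun a => ext_tr fun b => ?_
    simp only [LinearMap.compr₂_apply, mul_tr, elim_tr, detach_join, LinearMap.add_apply,
      LinearMap.comp_apply, LinearMap.compl₂_apply, LinearMap.flip_apply]
    congr 1
    simp only [Finsupp.lapply_apply, tr_apply, LinearMap.lsmul_apply]
    split_ifs <;> simp
  exact congrArg (fun f => f x y) this

theorem ins_bullet (s : Tree) : ins s (tr bullet) = mul (tr bullet) (tr s) := by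
  rw [ins_tr, attach_bullet, mul_tr]

theorem elim_bullet (s : Tree) : elim s (tr bullet) = 0 := by
  rw [elim_tr, detach_bullet]

theorem deg_bullet : deg (tr bullet) = tr bullet := by
  rw [deg_tr, size_bullet, Nat.cast_one, one_smul]

/-- Operators that agree on the one-vertex tree and satisfy the same recursion agree. -/
theorem op_ext {X Y : F →ₗ[ℂ] F} (h1 : X (tr bullet) = Y (tr bullet))
    (h2 : ∀ a b, X (tr a) = Y (tr a) → X (tr b) = Y (tr b) →
      X (mul (tr a) (tr b)) = Y (mul (tr a) (tr b))) : X = Y :=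
  ext_tr (Tree.induction h1 fun a b ha hb => by rw [← mul_tr]; exact h2 a b ha hb)

/-- The linear extension of `ins`. -/
def insL : F →ₗ[ℂ] (F →ₗ[ℂ] F) := Finsupp.linearCombination ℂ ins

/-- The linear extension of `elim`. -/
def elimL : F →ₗ[ℂ] (F →ₗ[ℂ] F) := Finsupp.linearCombination ℂ elim

theorem insL_tr (s : Tree) : insL (tr s) = ins s := by simp [insL, tr]

theorem elimL_tr (s : Tree) : elimL (tr s) = elim s := by simp [elimL, tr]

theorem insL_isDer (z : F) : IsDer (insL z) := by
  induction z using Finsupp.induction_linear with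
  | zero => intro x y; simp
  | add z w hz hw =>
    intro x y
    simp only [map_add, LinearMap.add_apply, hz x y, hw x y]
    abel
  | single a r =>
    have : (Finsupp.single a r : F) = r • tr a := by simp [tr]
    intro x y
    rw [this]
    simp only [map_smul, LinearMap.smul_apply, insL_tr, ins_isDer a x y, smul_add]

theorem insL_bullet (z : F) : insL z (tr bullet) = mul (tr bullet) z := by
  have : insL.flip (tr bullet) = mul (tr bullet) :=
    ext_tr fun s => by rw [LinearMap.flip_apply, insL_tr, ins_bullet]
  exact congrArg (fun f => f z) this

theorem elimL_bullet (z : F) : elimL z (tr bullet) = 0 := by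
  have : elimL.flip (tr bullet) = 0 :=
    ext_tr fun s => by rw [LinearMap.flip_apply, elimL_tr, elim_bullet]; rfl
  exact congrArg (fun f => f z) this

theorem elimL_mul (z x : F) (b : Tree) :
    elimL z (mul x (tr b)) = mul (elimL z x) (tr b) + mul x (elimL z (tr b)) + z b • x := by
  induction z using Finsupp.induction_linear with
  | zero => simp
  | add z w hz hw =>
    simp only [map_add, LinearMap.add_apply, hz, hw, Finsupp.add_apply, add_smul]
    abel
  | single a r =>
    have : (Finsupp.single a r : F) = r • tr a := by simp [tr]
    rw [this]
    simp only [map_smul, LinearMap.smul_apply, elimL_tr, elim_mul, smul_add, Finsupp.smul_apply]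
    congr 1
    simp only [tr_apply]
    by_cases h : a = b
    · subst h; simp
    · simp [h, Ne.symm h]

theorem ins_ins (s t : Tree) :
    ins s ∘ₗ ins t - ins t ∘ₗ ins s = insL (attach s t - attach t s) := by
  apply op_ext
  · simp only [LinearMap.sub_apply, LinearMap.comp_apply, ins_bullet, ins_isDer _ _ _,
      insL_bullet, map_sub]
    rw [ins_tr, ins_tr, mul_comm']
    abel
  · intro a b ha hb
    rw [insL_isDer, ← ha, ← hb]
    simp only [LinearMap.sub_apply, LinearMap.comp_apply, ins_isDer _ _ _, map_add, map_sub]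
    abel

theorem deg_ins (s : Tree) : deg ∘ₗ ins s - ins s ∘ₗ deg = (size s : ℂ) • ins s := by
  apply op_ext
  · simp only [LinearMap.sub_apply, LinearMap.comp_apply, LinearMap.smul_apply,
      ins_bullet, deg_isDer _ _, deg_tr, map_smul]
    abel
  · intro a b ha hb
    simp only [LinearMap.sub_apply, LinearMap.comp_apply, LinearMap.smul_apply] at ha hb
    simp only [LinearMap.sub_apply, LinearMap.comp_apply, LinearMap.smul_apply, deg_isDer _ _,
      ins_isDer _ _ _, map_add, smul_add]
    rw [← LinearMap.smul_apply, ← map_smul mul, ← map_smul (mul (tr a)), ← ha, ← hb]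
    simp only [map_sub, LinearMap.sub_apply]
    abel

theorem deg_elim (s : Tree) : deg ∘ₗ elim s - elim s ∘ₗ deg = -((size s : ℂ) • elim s) := by
  apply op_ext
  · simp [deg_bullet, elim_bullet]
  · intro a b ha hb
    have ha' : (size s : ℂ) • elim s (tr a) = elim s (deg (tr a)) - deg (elim s (tr a)) := by
      simp only [LinearMap.sub_apply, LinearMap.comp_apply, LinearMap.smul_apply,
        LinearMap.neg_apply] at ha
      rw [← neg_sub, ha, neg_neg]
    have hb' : (size s : ℂ) • elim s (tr b) = elim s (deg (tr b)) - deg (elim s (tr b)) := by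
      simp only [LinearMap.sub_apply, LinearMap.comp_apply, LinearMap.smul_apply,
        LinearMap.neg_apply] at hb
      rw [← neg_sub, hb, neg_neg]
    have hd : deg (tr b) s = (size s : ℂ) * tr b s := by
      rw [deg_tr]
      simp only [Finsupp.smul_apply, tr_apply, smul_eq_mul]
      split_ifs with h
      · rw [h]
      · simp
    simp only [LinearMap.sub_apply, LinearMap.comp_apply, LinearMap.smul_apply,
      LinearMap.neg_apply, deg_isDer _ _, elim_mul, map_add, smul_add, hd, map_smul]
    rw [← LinearMap.smul_apply (size s : ℂ) (mul _), ← map_smul mul, ← map_smul (mul (tr a)),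
      ha', hb']
    simp only [map_sub, LinearMap.sub_apply, mul_smul]
    abel

theorem elim_elim (s t : Tree) (z : F) (hz : ∀ r, z r = (alpha t r s : ℂ) - alpha s r t) :
    elim s ∘ₗ elim t - elim t ∘ₗ elim s = elimL z := by
  apply op_ext
  · simp [elim_bullet, elimL_bullet]
  · intro a b ha hb
    rw [elimL_mul, ← ha, ← hb, hz]
    have h1 : (alpha t b s : ℂ) = elim t (tr b) s := by rw [elim_tr]; rfl
    have h2 : (alpha s b t : ℂ) = elim s (tr b) t := by rw [elim_tr]; rfl
    rw [h1, h2]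
    simp only [LinearMap.sub_apply, LinearMap.comp_apply, elim_mul, map_add, map_sub, map_smul,
      sub_smul]
    abel

open scoped Classical in
theorem elim_ins (s t : Tree) (z : F) (hz : ∀ r, z r = (beta s t r : ℂ)) :
    elim s ∘ₗ ins t - ins t ∘ₗ elim s =
      insL (detach s t) + elimL z + (if s = t then deg else 0) := by
  have hX : ∀ x : F, (if s = t then deg else 0 : F →ₗ[ℂ] F) x = if s = t then deg x else 0 := by
    intro x; split_ifs <;> rfl
  apply op_ext
  · simp only [LinearMap.sub_apply, LinearMap.comp_apply, LinearMap.add_apply, hX, ins_bullet,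
      elim_bullet, insL_bullet, elimL_bullet, elim_mul, map_zero, deg_bullet, LinearMap.zero_apply]
    simp only [elim_tr, tr_apply, eq_comm (a := s)]
    split_ifs <;> simp
  · intro a b ha hb
    have hD : IsDer (if s = t then deg else 0 : F →ₗ[ℂ] F) := by
      split_ifs
      · exact deg_isDer
      · intro x y; simp
    have h1 : z b = ins t (tr b) s := by rw [hz, ins_tr]; rfl
    simp only [LinearMap.add_apply] at ha hb ⊢
    rw [elimL_mul, insL_isDer, hD]
    have e : mul (insL (detach s t) (tr a)) (tr b) + mul (tr a) (insL (detach s t) (tr b)) +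
        (mul (elimL z (tr a)) (tr b) + mul (tr a) (elimL z (tr b)) + z b • tr a) +
        (mul ((if s = t then deg else 0 : F →ₗ[ℂ] F) (tr a)) (tr b) +
          mul (tr a) ((if s = t then deg else 0 : F →ₗ[ℂ] F) (tr b))) =
        mul (insL (detach s t) (tr a) + elimL z (tr a) +
          (if s = t then deg else 0 : F →ₗ[ℂ] F) (tr a)) (tr b) +
        mul (tr a) (insL (detach s t) (tr b) + elimL z (tr b) +
          (if s = t then deg else 0 : F →ₗ[ℂ] F) (tr b)) + z b • tr a := by
      simp only [map_add, LinearMap.add_apply]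
      abel
    rw [e, ← ha, ← hb, h1]
    simp only [LinearMap.sub_apply, LinearMap.comp_apply, elim_mul, ins_isDer _ _ _, map_add,
      map_sub, map_smul]
    abel

end F


namespace Tree

theorem size_of_beta_ne_zero {r s t : Tree} (h : beta r s t ≠ 0) : size r = size s + size t := by
  induction r using Quotient.inductionOn with | _ r
  induction s using Quotient.inductionOn with | _ s
  induction t using Quotient.inductionOn with | _ t
  obtain ⟨⟨v, hv⟩, -⟩ := Nat.card_ne_zero.1 h
  refine (congrArg size hv).trans ?_
  change Nat.card (t.V ⊕ s.V) = _
  rw [Nat.card_sum, add_comm]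
  rfl

theorem beta_self (s r : Tree) : beta s s r = 0 := by
  by_contra h
  have := size_of_beta_ne_zero h
  have := size_pos r
  omega

theorem alpha_self (s r : Tree) : alpha s s r = 0 := by
  by_contra h
  exact (alpha_ne_zero_iff s s r).1 h (beta_self s r)

end Tree

/-- The labels of the basis `{d} ∪ {D⁺ₜ, D⁻ₜ}` of the insertion-elimination algebra. -/
inductive Gen : Type 1
  | d : Gen
  | pos (t : Tree) : Gen
  | neg (t : Tree) : Gen

/-- The underlying vector space of the insertion-elimination algebra `𝔤`: the complex vector space
with basis `{d} ∪ {D⁺ₜ, D⁻ₜ}`. -/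
def Alg : Type 1 := Gen →₀ ℂ

namespace Alg

open InsElim.Tree

instance : AddCommGroup Alg := inferInstanceAs (AddCommGroup (Gen →₀ ℂ))

instance : Module ℂ Alg := inferInstanceAs (Module ℂ (Gen →₀ ℂ))

/-- The standard basis. -/
def basis : Module.Basis Gen ℂ Alg := Module.Basis.ofRepr (LinearEquiv.refl ℂ (Gen →₀ ℂ))

/-- The basis element `d`. -/
def d : Alg := basis Gen.d

/-- The basis element `D⁺ₜ`. -/
def Dp (t : Tree) : Alg := basis (Gen.pos t)

/-- The basis element `D⁻ₜ`. -/
def Dm (t : Tree) : Alg := basis (Gen.neg t)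

open scoped Classical in
/-- The brackets of the basis elements. All the sums over trees `r` have finite support (see
`beta_finite`, `alpha_finite_mid`, `alpha_finite`, `beta_finite_right`). -/
def bracketGen : Gen → Gen → Alg
  | .pos s, .pos t => ∑ᶠ r : Tree, ((beta r s t : ℂ) - beta r t s) • Dp r
  | .neg s, .neg t => ∑ᶠ r : Tree, ((alpha t r s : ℂ) - alpha s r t) • Dm r
  | .neg s, .pos t =>
    if s = t then d
    else ∑ᶠ r : Tree, (alpha s t r : ℂ) • Dp r + ∑ᶠ r : Tree, (beta s t r : ℂ) • Dm r
  | .pos t, .neg s =>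
    -(if s = t then d
      else ∑ᶠ r : Tree, (alpha s t r : ℂ) • Dp r + ∑ᶠ r : Tree, (beta s t r : ℂ) • Dm r)
  | .d, .neg t => -((size t : ℂ) • Dm t)
  | .neg t, .d => (size t : ℂ) • Dm t
  | .d, .pos t => (size t : ℂ) • Dp t
  | .pos t, .d => -((size t : ℂ) • Dp t)
  | .d, .d => 0

/-- The bilinear extension of `bracketGen`. -/
def bracket : Alg →ₗ[ℂ] Alg →ₗ[ℂ] Alg :=
  basis.constr ℂ fun x => basis.constr ℂ fun y => bracketGen x y

theorem bracket_basis (x y : Gen) : bracket (basis x) (basis y) = bracketGen x y := by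
  rw [bracket, Module.Basis.constr_basis, Module.Basis.constr_basis]

/-- The action of the basis elements on the space spanned by the trees. -/
def rhoGen : Gen → (F →ₗ[ℂ] F)
  | .d => F.deg
  | .pos t => F.ins t
  | .neg t => F.elim t

/-- The action on the space spanned by the trees. -/
def rho : Alg →ₗ[ℂ] (F →ₗ[ℂ] F) := basis.constr ℂ rhoGen

theorem rho_basis (x : Gen) : rho (basis x) = rhoGen x := basis.constr_basis ℂ _ _

theorem rho_d : rho d = F.deg := rho_basis _

theorem rho_Dp (t : Tree) : rho (Dp t) = F.ins t := rho_basis _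

theorem rho_Dm (t : Tree) : rho (Dm t) = F.elim t := rho_basis _

theorem finsum_smul {M : Type*} [AddCommGroup M] [Module ℂ M] (c : F) (k : Tree → ℂ)
    (h : ∀ r, c r = k r) (f : Tree → M) :
    ∑ᶠ r, k r • f r = Finsupp.linearCombination ℂ f c := by
  have hk : k = c := funext fun r => (h r).symm
  subst hk
  rw [Finsupp.linearCombination_apply, Finsupp.sum]
  refine finsum_eq_sum_of_support_subset _ fun r hr => ?_
  by_contra hr'
  have : c r = 0 := by simpa using hr'
  simp [this] at hr

theorem rho_sum_Dp (c : F) (k : Tree → ℂ) (h : ∀ r, c r = k r) :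
    rho (∑ᶠ r, k r • Dp r) = F.insL c := by
  rw [finsum_smul c k h]
  have : rho ∘ₗ Finsupp.linearCombination ℂ Dp = F.insL :=
    F.ext_tr fun s => by
      rw [F.insL_tr]
      simp [F.tr, rho_Dp]
  exact congrArg (fun f => f c) this

theorem rho_sum_Dm (c : F) (k : Tree → ℂ) (h : ∀ r, c r = k r) :
    rho (∑ᶠ r, k r • Dm r) = F.elimL c := by
  rw [finsum_smul c k h]
  have : rho ∘ₗ Finsupp.linearCombination ℂ Dm = F.elimL :=
    F.ext_tr fun s => by
      rw [F.elimL_tr]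
      simp [F.tr, rho_Dm]
  exact congrArg (fun f => f c) this

open scoped Classical in
theorem rho_neg_pos (s t : Tree) (x : F) : rho (bracketGen (.neg s) (.pos t)) x =
    F.elim s (F.ins t x) - F.ins t (F.elim s x) := by
  let z : F := Finsupp.ofSupportFinite (fun r => (beta s t r : ℂ))
    ((beta_finite_right s t).subset fun r hr => by simpa using hr)
  have key := congrArg (fun f => f x) (F.elim_ins s t z fun _ => rfl)
  refine Eq.trans ?_ key.symm
  simp only [bracketGen]
  split_ifs with h
  · subst h
    have h1 : F.detach s s = 0 := Finsupp.ext fun r => by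
      change (alpha s s r : ℂ) = 0
      rw [alpha_self, Nat.cast_zero]
    have h2 : z = 0 := Finsupp.ext fun r => by
      change (beta s s r : ℂ) = 0
      rw [beta_self, Nat.cast_zero]
    rw [h1, h2, rho_d]
    simp
  · have e1 := rho_sum_Dp (F.detach s t) (fun r => (alpha s t r : ℂ)) fun _ => rfl
    have e2 := rho_sum_Dm z (fun r => (beta s t r : ℂ)) fun _ => rfl
    rw [map_add, e1, e2, add_zero]

theorem bracketGen_skew (x y : Gen) : bracketGen x y = -bracketGen y x := by
  have key : ∀ (f g : Tree → ℂ) (D : Tree → Alg),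
      ∑ᶠ r, (f r - g r) • D r = -∑ᶠ r, (g r - f r) • D r := by
    intro f g D
    rw [← finsum_neg_distrib]
    exact finsum_congr fun r => by rw [← neg_smul, neg_sub]
  cases x <;> cases y <;> simp only [bracketGen, neg_neg, neg_zero]
  · exact key _ _ _
  · exact key _ _ _

theorem rho_bracketGen (x y : Gen) (v : F) :
    rho (bracketGen x y) v = rhoGen x (rhoGen y v) - rhoGen y (rhoGen x v) := by
  have swap : ∀ x y, rho (bracketGen x y) v = rhoGen x (rhoGen y v) - rhoGen y (rhoGen x v) →
      rho (bracketGen y x) v = rhoGen y (rhoGen x v) - rhoGen x (rhoGen y v) := by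
    intro x y h
    rw [bracketGen_skew, map_neg, LinearMap.neg_apply, h, neg_sub]
  have h_pos : ∀ t, rho (bracketGen .d (.pos t)) v =
      F.deg (F.ins t v) - F.ins t (F.deg v) := by
    intro t
    refine Eq.trans ?_ (congrArg (fun f => f v) (F.deg_ins t)).symm
    rw [bracketGen, map_smul, rho_Dp]
  have h_neg : ∀ t, rho (bracketGen .d (.neg t)) v =
      F.deg (F.elim t v) - F.elim t (F.deg v) := by
    intro t
    refine Eq.trans ?_ (congrArg (fun f => f v) (F.deg_elim t)).symm
    rw [bracketGen, map_neg, map_smul, rho_Dm]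
  cases x with
  | d =>
    cases y with
    | d => rw [bracketGen, map_zero, LinearMap.zero_apply, sub_self]
    | pos t => exact h_pos t
    | neg t => exact h_neg t
  | pos s =>
    cases y with
    | d => exact swap _ _ (h_pos s)
    | pos t =>
      refine Eq.trans ?_ (congrArg (fun f => f v) (F.ins_ins s t)).symm
      have e := rho_sum_Dp (F.attach s t - F.attach t s)
        (fun r => (beta r s t : ℂ) - beta r t s) fun r => by rw [Finsupp.sub_apply]; rfl
      rw [bracketGen, e]
    | neg t => exact swap _ _ (rho_neg_pos t s v)
  | neg s =>
    cases y with
    | d => exact swap _ _ (h_neg s)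
    | pos t => exact rho_neg_pos s t v
    | neg t =>
      let z : F := Finsupp.ofSupportFinite (fun r => (alpha t r s : ℂ) - alpha s r t)
        (((alpha_finite_mid t s).union (alpha_finite_mid s t)).subset fun r hr => by
          by_contra h
          simp only [Set.mem_union, Set.mem_ofPred_eq, not_or, not_not] at h
          simp [h.1, h.2] at hr)
      refine Eq.trans ?_ (congrArg (fun f => f v) (F.elim_elim s t z fun _ => rfl)).symm
      have e := rho_sum_Dm z (fun r => (alpha t r s : ℂ) - alpha s r t) fun _ => rfl
      rw [bracketGen, e]

theorem rho_bracket (x y : Alg) (v : F) :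
    rho (bracket x y) v = rho x (rho y v) - rho y (rho x v) := by
  have h1 : LinearMap.compr₂ bracket (rho.flip v) + (rho.compl₂ (rho.flip v)).flip =
      rho.compl₂ (rho.flip v) := by
    refine basis.ext fun x => basis.ext fun y => ?_
    simp only [LinearMap.compr₂_apply, LinearMap.flip_apply, LinearMap.add_apply,
      LinearMap.compl₂_apply, bracket_basis, rho_bracketGen, rho_basis]
    abel
  exact eq_sub_of_add_eq (congrArg (fun f => f x y) h1)

theorem rho_injective : Function.Injective rho := by
  rw [injective_iff_map_eq_zero]
  intro x hx
  have h_mul : ∀ a b : F, F.mul a b bullet = 0 := F.mul_apply_bullet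
  have b1 : F.tr bullet bullet = 1 := by simp [F.tr]
  have h0 : basis.coord Gen.d = Finsupp.lapply bullet ∘ₗ rho.flip (F.tr bullet) := by
    refine basis.ext fun y => ?_
    cases y <;> simp [rho_basis, rhoGen, F.deg_bullet, F.ins_bullet, F.elim_bullet, h_mul, b1]
  have hp : ∀ t, basis.coord (Gen.pos t) =
      Finsupp.lapply bullet ∘ₗ F.elim t ∘ₗ rho.flip (F.tr bullet) := by
    intro t
    refine basis.ext fun y => ?_
    cases y with
    | d => simp [rho_basis, rhoGen, F.deg_bullet, F.elim_bullet]
    | neg s => simp [rho_basis, rhoGen, F.elim_bullet]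
    | pos s =>
      simp only [LinearMap.comp_apply, rho_basis, rhoGen, LinearMap.flip_apply,
        F.ins_bullet, F.elim_mul, F.elim_bullet,
        Finsupp.lapply_apply, Finsupp.add_apply, h_mul, Finsupp.smul_apply, b1]
      classical
      simp [Finsupp.single_apply, F.tr]
  have hn : ∀ t, basis.coord (Gen.neg t) =
      Finsupp.lapply bullet ∘ₗ rho.flip (F.mul (F.tr bullet) (F.tr t)) := by
    intro t
    refine basis.ext fun y => ?_
    cases y with
    | d => simp [rho_basis, rhoGen, F.deg_isDer _ _, h_mul]
    | pos s => simp [rho_basis, rhoGen, F.ins_isDer _ _ _, h_mul]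
    | neg s =>
      simp only [LinearMap.comp_apply, rho_basis, rhoGen, LinearMap.flip_apply, F.elim_mul,
        Finsupp.lapply_apply, Finsupp.add_apply, h_mul, Finsupp.smul_apply, b1]
      classical
      simp [Finsupp.single_apply, F.tr, eq_comm]
  refine basis.ext_elem fun y => ?_
  have ev : ∀ (f g : Alg →ₗ[ℂ] ℂ), f = g → f x = g x := fun f g h => by rw [h]
  cases y with
  | d => exact (ev _ _ h0).trans (by simp [hx])
  | pos t => exact (ev _ _ (hp t)).trans (by simp [hx])
  | neg t => exact (ev _ _ (hn t)).trans (by simp [hx])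

/-- The insertion-elimination algebra as a Lie ring. The Jacobi identity is verified through the
faithful action `rho` by insertions and eliminations on the space spanned by the trees. -/
instance : LieRing Alg where
  bracket x y := bracket x y
  add_lie x y z := by
    change bracket (x + y) z = bracket x z + bracket y z
    rw [map_add, LinearMap.add_apply]
  lie_add x y z := map_add (bracket x) y z
  lie_self x := rho_injective (LinearMap.ext fun v => by
    change rho (bracket x x) v = rho 0 v
    rw [rho_bracket, sub_self, map_zero, LinearMap.zero_apply])
  leibniz_lie x y z := rho_injective (LinearMap.ext fun v => by
    change rho (bracket x (bracket y z)) v =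
      rho (bracket (bracket x y) z + bracket y (bracket x z)) v
    simp only [map_add, LinearMap.add_apply, rho_bracket, map_sub]
    abel)

/-- The insertion-elimination algebra as a complex Lie algebra. -/
instance : LieAlgebra ℂ Alg where
  lie_smul c x y := map_smul (bracket x) c y

/-! The defining relations. -/

theorem lie_basis (x y : Gen) : ⁅basis x, basis y⁆ = bracketGen x y := bracket_basis x y

theorem lie_Dp_Dp (s t : Tree) :
    ⁅Dp s, Dp t⁆ = ∑ᶠ r : Tree, ((beta r s t : ℂ) - beta r t s) • Dp r := lie_basis _ _

theorem lie_Dm_Dm (s t : Tree) :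
    ⁅Dm s, Dm t⁆ = ∑ᶠ r : Tree, ((alpha t r s : ℂ) - alpha s r t) • Dm r := lie_basis _ _

theorem lie_Dm_Dp {s t : Tree} (h : s ≠ t) :
    ⁅Dm s, Dp t⁆ =
      ∑ᶠ r : Tree, (alpha s t r : ℂ) • Dp r + ∑ᶠ r : Tree, (beta s t r : ℂ) • Dm r :=
  (lie_basis _ _).trans (by simp [bracketGen, h])

theorem lie_Dm_Dp_self (t : Tree) : ⁅Dm t, Dp t⁆ = d :=
  (lie_basis _ _).trans (by simp [bracketGen])

theorem lie_d_Dm (t : Tree) : ⁅d, Dm t⁆ = -((size t : ℂ) • Dm t) := lie_basis _ _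

theorem lie_d_Dp (t : Tree) : ⁅d, Dp t⁆ = (size t : ℂ) • Dp t := lie_basis _ _

end Alg

section Cohomology

variable (R : Type*) [CommRing R] (L : Type*) [LieRing L] [LieAlgebra R L]
  (M : Type*) [AddCommGroup M] [Module R M] [LieRingModule L M] [LieModule R L M]

/-- The coboundary map from `0`-cochains to `1`-cochains, `m ↦ (x ↦ ⁅x, m⁆)`. -/
def d₀₁ : M →ₗ[R] LieModule.Cohomology.oneCochain R L M :=
  (LieModule.toEnd R L M : L →ₗ[R] Module.End R M).flip

/-- The first cohomology `H¹(L, M)` of the Lie algebra `L` with coefficients in `M`: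
`1`-cocycles modulo `1`-coboundaries. -/
abbrev H1 : Type _ :=
  LinearMap.ker (LieModule.Cohomology.d₁₂ R L M) ⧸
    (LinearMap.range (d₀₁ R L M)).submoduleOf (LinearMap.ker (LieModule.Cohomology.d₁₂ R L M))

/-- The space of inner derivations `x ↦ ⁅x, m⁆` from `L` to `M`. -/
abbrev Inn : Submodule R (LieDerivation R L M) := LinearMap.range (LieDerivation.inner R L M)

end Cohomology

end InsElim

end

/-!
Every derivation of the insertion-elimination algebra is inner.

The element `d` acts semisimply: `ad d` multiplies `D⁺ₜ` by `|t|`, `D⁻ₜ` by `-|t|` and `d` by `0`.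
So the inner derivation of a suitable element removes from `φ d` all components of nonzero degree,
leaving a multiple of `d`; applying `φ` to `⁅d, D⁺⁆ = D⁺`, where `D⁺` belongs to the one-vertex
tree, shows that this multiple is zero (`Alg.exists_sub_inner_apply_d_eq_zero`). A derivation with
`φ d = 0` commutes with `ad d`, hence preserves the degree (`Alg.repr_eq_zero_of_wt_ne`). As the
part of degree one is spanned by the `D⁺` of the one-vertex tree, a multiple of `ad d` corrects
`φ` so that it kills this element too.

A derivation that kills `d` and the `D⁺` of the one-vertex tree vanishes, by induction on the
number of vertices (`Alg.apply_Dp_eq_zero`, `Alg.apply_Dm_eq_zero`). If it kills `D⁺ₛ` and `D⁻ₛ`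
for `|s| < |t|`, then `φ (D⁺ₜ)` is a combination of the `D⁺ᵣ` with `|r| = |t|`, and its bracket with
each of these `D⁻ₛ` is zero. So the corresponding combination of trees is killed by every
elimination, and hence it is a multiple of the one-vertex tree
(`F.apply_eq_zero_of_elim_eq_zero`): this statement is dual to the fact that the trees are
generated from the one-vertex tree by grafting. Finally `φ (D⁻ₜ) = 0`, because for `|r| = |t|` the
bracket of `D⁻ₜ` with `D⁺ᵣ` is `d` or zero, and so detects the coefficients.

The statement on cohomology holds because `1`-cocycles with values in the adjoint module are
derivations, and coboundaries are the inner ones (`h1EquivDerivationModInner`).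
-/

noncomputable section

namespace InsElim

/-! ### Trees and the joint kernel of the eliminations -/

namespace RTree

/-- The number of neighbours of the root. -/
def rdeg (t : RTree) : ℕ := Nat.card {w // t.graph.Adj t.root w}

theorem rdeg_eq_of_iso {s t : RTree} (f : Iso s t) : s.rdeg = t.rdeg :=
  Nat.card_congr (f.toIso.toEquiv.subtypeEquiv fun w => by
    rw [← f.map_root]
    exact f.toIso.map_adj_iff.symm)

theorem rdeg_graft_root (s t : RTree) : (s.graft s.root t).rdeg = s.rdeg + 1 := by
  have h : Unique {w : t.V // (s.graft s.root t).graph.Adj (Sum.inl s.root) (Sum.inr w)} :=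
    ⟨⟨⟨t.root, by simp [graft, SimpleGraph.edge_adj]⟩⟩, fun w => Subtype.ext (by
      simpa [graft, SimpleGraph.edge_adj] using w.2)⟩
  refine (Nat.card_congr (Equiv.subtypeSum)).trans ?_
  rw [Nat.card_sum]
  refine congrArg₂ (· + ·) (Nat.card_congr (Equiv.subtypeEquivRight fun w => ?_)) Nat.card_unique
  simp [graft, SimpleGraph.edge_adj]

theorem rdeg_graft_of_ne_root {s : RTree} {v : s.V} (hv : v ≠ s.root) (t : RTree) :
    (s.graft v t).rdeg = s.rdeg := by
  have h : IsEmpty {w : t.V // (s.graft v t).graph.Adj (Sum.inl s.root) (Sum.inr w)} :=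
    ⟨fun w => hv (by have := w.2; simp [graft, SimpleGraph.edge_adj] at this; exact this.1.symm)⟩
  refine (Nat.card_congr (Equiv.subtypeSum)).trans ?_
  rw [Nat.card_sum]
  refine (congrArg₂ (· + ·) (Nat.card_congr (Equiv.subtypeEquivRight fun w => ?_))
    (@Nat.card_of_isEmpty _ h)).trans (add_zero _)
  simp [graft, SimpleGraph.edge_adj]

end RTree

namespace Tree

/-- The number of neighbours of the root. -/
def rdeg : Tree → ℕ :=
  Quotient.lift RTree.rdeg fun _ _ (h : Nonempty (RTree.Iso _ _)) =>
    h.elim fun f => RTree.rdeg_eq_of_iso f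

theorem beta_join_ne_zero (a b : Tree) : beta (join a b) b a ≠ 0 := by
  induction a using Quotient.inductionOn with | _ a
  induction b using Quotient.inductionOn with | _ b
  exact Nat.card_ne_zero.2 ⟨⟨⟨a.root, rfl⟩⟩, inferInstance⟩

/-- Among the trees obtained by grafting `b` onto `a`, only the one grafted at the root has the
largest root degree. -/
theorem eq_join_or_rdeg_lt {r a b : Tree} (h : beta r b a ≠ 0) :
    r = join a b ∨ rdeg r < rdeg (join a b) := by
  induction a using Quotient.inductionOn with | _ a
  induction b using Quotient.inductionOn with | _ b
  obtain ⟨⟨v, rfl⟩, -⟩ := Nat.card_ne_zero.1 h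
  by_cases hv : v = a.root
  · subst hv
    exact Or.inl rfl
  · refine Or.inr ?_
    change (a.graft v b).rdeg < (a.graft a.root b).rdeg
    rw [RTree.rdeg_graft_root, RTree.rdeg_graft_of_ne_root hv]
    exact Nat.lt_succ_self _

theorem size_of_alpha_ne_zero {s t r : Tree} (h : alpha s t r ≠ 0) : size t = size s + size r :=
  size_of_beta_ne_zero ((alpha_ne_zero_iff s t r).1 h)

theorem eq_bullet_of_size_eq_one {t : Tree} (h : size t = 1) : t = bullet := by
  rcases eq_bullet_or_join t with rfl | ⟨a, b, rfl⟩
  · rfl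
  · have := size_pos a
    have := size_pos b
    rw [size_join] at h
    omega

end Tree

namespace F

open InsElim.Tree

theorem elim_apply (s : Tree) (x : F) (a : Tree) :
    elim s x a = x.sum fun r c => c * (alpha s r a : ℂ) := by
  rw [elim, Finsupp.linearCombination_apply, Finsupp.sum, Finsupp.sum, Finsupp.finsetSum_apply]
  rfl

/-- A combination of trees killed by all eliminations is a multiple of the one-vertex tree.
The coefficient of `a` in the elimination of `b` is a nonzero multiple of the coefficient of
`join a b`, plus coefficients of trees of smaller root degree. -/
theorem apply_eq_zero_of_elim_eq_zero {x : F} (hx : ∀ s, elim s x = 0) {t : Tree}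
    (ht : t ≠ bullet) : x t = 0 := by
  induction hn : rdeg t using Nat.strong_induction_on generalizing t with
  | _ n ih =>
    obtain ⟨a, b, rfl⟩ := (eq_bullet_or_join t).resolve_left ht
    have h := DFunLike.congr_fun (hx b) a
    rw [elim_apply, Finsupp.zero_apply, Finsupp.sum_eq_single (join a b)] at h
    · refine (mul_eq_zero.1 h).resolve_right (Nat.cast_ne_zero.2 ?_)
      exact (alpha_ne_zero_iff _ _ _).2 (beta_join_ne_zero a b)
    · intro r _ hr
      by_cases hα : alpha b r a = 0
      · rw [hα, Nat.cast_zero, mul_zero]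
      have hlt := (eq_join_or_rdeg_lt ((alpha_ne_zero_iff _ _ _).1 hα)).resolve_left hr
      rw [ih _ (hn ▸ hlt) ?_ rfl, zero_mul]
      rintro rfl
      have h1 := size_of_alpha_ne_zero hα
      have := size_pos a
      have := size_pos b
      rw [size_bullet] at h1
      omega
    · intro _
      exact zero_mul _

end F

/-! ### Coordinates in the insertion-elimination algebra -/

/-- The degree of a basis element: its eigenvalue under `ad d`. -/
def Gen.wt : Gen → ℤ
  | .d => 0
  | .pos t => Tree.size t
  | .neg t => -Tree.size t

namespace Alg

open InsElim.Tree

theorem lie_d_basis (x : Gen) : ⁅d, basis x⁆ = (x.wt : ℂ) • basis x := by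
  refine (lie_basis _ _).trans ?_
  cases x <;> simp [bracketGen, Gen.wt, Dp, Dm]

theorem repr_lie_d (x : Alg) (y : Gen) : basis.repr ⁅d, x⁆ y = y.wt * basis.repr x y := by
  have : basis.coord y ∘ₗ bracket d = (y.wt : ℂ) • basis.coord y := by
    refine basis.ext fun z => ?_
    change basis.repr ⁅d, basis z⁆ y = y.wt * basis.repr (basis z) y
    rw [lie_d_basis, map_smul, Finsupp.smul_apply, smul_eq_mul, Module.Basis.repr_self]
    by_cases h : z = y
    · rw [h]
    · rw [Finsupp.single_eq_of_ne' h, mul_zero, mul_zero]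
  exact congrArg (fun f => f x) this

theorem wt_eq_zero_iff {x : Gen} : x.wt = 0 ↔ x = .d := by
  cases x with
  | d => simp [Gen.wt]
  | pos t => simpa [Gen.wt] using (size_pos t).ne'
  | neg t => simpa [Gen.wt] using (size_pos t).ne'

theorem repr_finsum_smul {c : Tree → ℂ} (hc : c.support.Finite) (g : Tree → Gen) (y : Gen) :
    basis.repr (∑ᶠ r, c r • basis (g r)) y = ∑ᶠ r, c r * (Finsupp.single (g r) (1 : ℂ)) y := by
  have h : (Function.support fun r => c r • basis (g r)).Finite :=
    hc.subset fun r hr h => hr (by simp [h])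
  refine ((basis.coord y).toAddMonoidHom.map_finsum h).trans (finsum_congr fun r => ?_)
  simp

/-- The coefficients at the `D⁺ₐ` of a bracket with `D⁻ₛ` are given by the elimination of `s`. -/
theorem repr_lie_Dm_pos (s a : Tree) (x : F) :
    basis.repr ⁅Dm s, Finsupp.linearCombination ℂ Dp x⁆ (.pos a) = F.elim s x a := by
  have : basis.coord (.pos a) ∘ₗ bracket (Dm s) ∘ₗ Finsupp.linearCombination ℂ Dp =
      Finsupp.lapply a ∘ₗ F.elim s := by
    refine F.ext_tr fun t => ?_
    simp only [LinearMap.comp_apply, F.elim_tr]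
    rw [F.tr, Finsupp.linearCombination_single, one_smul]
    change basis.repr ⁅Dm s, Dp t⁆ (.pos a) = (alpha s t a : ℂ)
    by_cases h : s = t
    · subst h
      simp [lie_Dm_Dp_self, alpha_self, d]
    · rw [lie_Dm_Dp h, map_add, Finsupp.add_apply]
      erw [repr_finsum_smul ((alpha_finite s t).subset fun r hr => by simpa using hr) Gen.pos,
        repr_finsum_smul ((beta_finite_right s t).subset fun r hr => by simpa using hr) Gen.neg]
      rw [finsum_eq_single _ a fun r hr => by
        rw [Finsupp.single_eq_of_ne' (by simpa using hr), mul_zero]]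
      simp
  exact congrArg (fun f => f x) this

/-- The coefficient at `d` of a bracket with `D⁺ᵣ` is the coefficient of `D⁻ᵣ`. -/
theorem repr_lie_Dp_d (x : Alg) (r : Tree) :
    basis.repr ⁅x, Dp r⁆ .d = basis.repr x (.neg r) := by
  have : basis.coord .d ∘ₗ bracket.flip (Dp r) = basis.coord (.neg r) := by
    refine basis.ext fun y => ?_
    change basis.repr ⁅basis y, Dp r⁆ .d = basis.repr (basis y) (.neg r)
    cases y with
    | d =>
      change basis.repr ⁅d, Dp r⁆ .d = _
      rw [lie_d_Dp]
      simp [Dp]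
    | pos t =>
      change basis.repr ⁅Dp t, Dp r⁆ .d = _
      rw [lie_Dp_Dp]
      erw [repr_finsum_smul (((beta_finite t r).union (beta_finite r t)).subset fun q hq => by
        by_contra h
        simp only [Set.mem_union, Set.mem_ofPred_eq, not_or, not_not] at h
        simp [h.1, h.2] at hq) Gen.pos]
      simp
    | neg t =>
      change basis.repr ⁅Dm t, Dp r⁆ .d = _
      by_cases h : t = r
      · subst h
        simp [lie_Dm_Dp_self, d]
      · rw [lie_Dm_Dp h, map_add, Finsupp.add_apply]
        erw [repr_finsum_smul ((alpha_finite t r).subset fun q hq => by simpa using hq) Gen.pos,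
          repr_finsum_smul ((beta_finite_right t r).subset fun q hq => by simpa using hq) Gen.neg]
        simp [Finsupp.single_eq_of_ne' (a := Gen.neg t) (a' := .neg r) (by simpa using h)]
  exact congrArg (fun f => f x) this

/-! ### Derivations -/

variable {φ : LieDerivation ℂ Alg Alg}

/-- A derivation that kills the grading element `d` preserves the degree. -/
theorem repr_eq_zero_of_wt_ne (hd : φ d = 0) {x y : Gen} (h : y.wt ≠ x.wt) :
    basis.repr (φ (basis x)) y = 0 := by
  have h1 := φ.apply_lie_eq_add d (basis x)
  rw [hd, zero_lie, add_zero, lie_d_basis, map_smul] at h1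
  have h2 := congrArg (fun z => basis.repr z y) h1
  simp only [map_smul, Finsupp.smul_apply, repr_lie_d, smul_eq_mul] at h2
  have h3 : ((x.wt : ℂ) - y.wt) * basis.repr (φ (basis x)) y = 0 := by
    rw [sub_mul, h2, sub_self]
  refine (mul_eq_zero.1 h3).resolve_left ?_
  exact sub_ne_zero.2 (by exact_mod_cast h.symm)

theorem apply_lie_Dm_Dp_eq_zero (hd : φ d = 0) {s t : Tree} (hst : size s ≤ size t)
    (h : ∀ r, size r < size t → φ (Dp r) = 0) : φ ⁅Dm s, Dp t⁆ = 0 := by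
  by_cases hs : s = t
  · rw [hs, lie_Dm_Dp_self, hd]
  rw [lie_Dm_Dp hs, map_add]
  have hadd : ∀ u v : Alg, φ u = 0 → φ v = 0 → φ (u + v) = 0 := fun u v hu hv => by
    rw [map_add, hu, hv, add_zero]
  rw [finsum_induction (p := fun u => φ u = 0) (map_zero φ) hadd,
    finsum_induction (p := fun u => φ u = 0) (map_zero φ) hadd, add_zero]
  · intro r
    have h0 : beta s t r = 0 := by
      by_contra h0
      have := size_of_beta_ne_zero h0
      have := size_pos r
      omega
    rw [h0, Nat.cast_zero, zero_smul, map_zero]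
  · intro r
    by_cases h0 : alpha s t r = 0
    · rw [h0, Nat.cast_zero, zero_smul, map_zero]
    · have h1 := size_of_alpha_ne_zero h0
      have := size_pos s
      rw [map_smul, h r (by omega), smul_zero]

/-- The coefficient of `D⁻ᵣ` in the image of `D⁻ₜ` is detected by the bracket with `D⁺ᵣ`. -/
theorem apply_Dm_eq_zero (hd : φ d = 0) {t : Tree}
    (h : ∀ r, size r ≤ size t → φ (Dp r) = 0) : φ (Dm t) = 0 := by
  refine basis.ext_elem fun y => ?_
  rw [map_zero, Finsupp.zero_apply]
  by_cases hy : y.wt = (Gen.neg t).wt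
  · cases y with
    | d =>
      have := size_pos t
      simp only [Gen.wt] at hy
      omega
    | pos r =>
      have := size_pos t
      simp only [Gen.wt] at hy
      omega
    | neg r =>
      have hr : size r = size t := by simpa [Gen.wt] using hy
      have h1 := φ.apply_lie_eq_add (Dm t) (Dp r)
      rw [apply_lie_Dm_Dp_eq_zero hd hr.ge fun q hq => h q (hq.le.trans hr.le), h r hr.le,
        lie_zero, zero_add] at h1
      rw [← repr_lie_Dp_d, ← h1, map_zero, Finsupp.zero_apply]
  · exact repr_eq_zero_of_wt_ne hd hy

/-- If a derivation kills `d` and `D⁺` of the one-vertex tree, it kills all `D⁺ₜ`. By induction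
on `|t|`, the image of `D⁺ₜ` commutes with the `D⁻ₛ` with `|s| < |t|`, so the corresponding
combination of trees is killed by all eliminations. -/
theorem apply_Dp_eq_zero (hd : φ d = 0) (hb : φ (Dp bullet) = 0)
    (t : Tree) : φ (Dp t) = 0 := by
  induction hn : size t using Nat.strong_induction_on generalizing t with
  | _ n ih =>
    subst hn
    by_cases ht : t = bullet
    · rw [ht, hb]
    have ih' : ∀ r, size r < size t → φ (Dp r) = 0 := fun r hr => ih _ hr r rfl
    have hinj : Function.Injective Gen.pos := fun _ _ h => Gen.pos.inj h
    let x : F := (basis.repr (φ (Dp t))).comapDomain Gen.pos hinj.injOn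
    have hx0 : ∀ r, size r ≠ size t → x r = 0 := fun r hr =>
      repr_eq_zero_of_wt_ne hd (x := .pos t) (y := .pos r) (by simpa [Gen.wt] using hr)
    have hx : φ (Dp t) = Finsupp.linearCombination ℂ Dp x := by
      have hmap : basis.repr (Finsupp.linearCombination ℂ Dp x) = x.mapDomain Gen.pos := by
        have : basis.repr.toLinearMap ∘ₗ Finsupp.linearCombination ℂ Dp =
            Finsupp.lmapDomain ℂ ℂ Gen.pos := F.ext_tr fun s => by simp [F.tr, Dp]
        exact congrArg (fun f => f x) this
      refine basis.ext_elem fun y => ?_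
      rw [hmap]
      cases y with
      | pos r => rw [Finsupp.mapDomain_apply hinj]; rfl
      | d =>
        rw [Finsupp.mapDomain_of_notMem_range _ _ (by simp)]
        refine repr_eq_zero_of_wt_ne hd (x := .pos t) ?_
        have := size_pos t
        simp only [Gen.wt]
        omega
      | neg r =>
        rw [Finsupp.mapDomain_of_notMem_range _ _ (by simp)]
        refine repr_eq_zero_of_wt_ne hd (x := .pos t) ?_
        have := size_pos t
        simp only [Gen.wt]
        omega
    have hel : ∀ s, F.elim s x = 0 := by
      intro s
      ext a
      by_cases hs : size s < size t
      · have h1 := φ.apply_lie_eq_add (Dm s) (Dp t)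
        rw [apply_lie_Dm_Dp_eq_zero hd hs.le ih',
          apply_Dm_eq_zero hd fun r hr => ih' r (hr.trans_lt hs), zero_lie, add_zero, hx] at h1
        rw [← repr_lie_Dm_pos, ← h1, map_zero]
        rfl
      · rw [F.elim_apply]
        refine Finset.sum_eq_zero fun r hr => ?_
        have hrt : size r = size t := by
          by_contra h
          exact Finsupp.mem_support_iff.1 hr (hx0 r h)
        have h0 : alpha s r a = 0 := by
          by_contra h0
          have := size_of_alpha_ne_zero h0
          have := size_pos a
          omega
        change x r * _ = 0
        rw [h0, Nat.cast_zero, mul_zero]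
    have : x = 0 := by
      ext r
      by_cases hr : r = bullet
      · refine hx0 r fun h => ht (eq_bullet_of_size_eq_one ?_)
        rw [← h, hr, size_bullet]
      · exact F.apply_eq_zero_of_elim_eq_zero hel hr
    rw [hx, this, map_zero]

theorem eq_zero_of_apply_eq_zero (hd : φ d = 0) (hb : φ (Dp bullet) = 0) : φ = 0 := by
  have h := apply_Dp_eq_zero hd hb
  have : (φ : Alg →ₗ[ℂ] Alg) = 0 := basis.ext fun x => by
    cases x with
    | d => exact hd
    | pos t => exact h t
    | neg t => exact apply_Dm_eq_zero hd fun r _ => h r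
  exact LieDerivation.ext fun x => LinearMap.congr_fun this x

/-- Up to an inner derivation, every derivation kills `d`. -/
theorem exists_sub_inner_apply_d_eq_zero (φ : LieDerivation ℂ Alg Alg) :
    ∃ m : Alg, (φ - LieDerivation.inner ℂ Alg Alg m) d = 0 := by
  -- `ad d` inverted on the nonzero degrees; in degree `0` the inverse below is the junk value `0`
  let m : Alg := Finsupp.linearCombination ℂ (fun y : Gen => (y.wt : ℂ)⁻¹ • basis y)
    (basis.repr (φ d))
  have hm : ∀ y, basis.repr m y = (y.wt : ℂ)⁻¹ * basis.repr (φ d) y := by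
    intro y
    have : basis.coord y ∘ₗ Finsupp.linearCombination ℂ (fun y : Gen => (y.wt : ℂ)⁻¹ • basis y) =
        (y.wt : ℂ)⁻¹ • Finsupp.lapply y := by
      refine Finsupp.lhom_ext' fun z => LinearMap.ext_ring ?_
      by_cases h : z = y
      · subst h; simp
      · simp [Finsupp.single_eq_of_ne' h]
    exact congrArg (fun f => f (basis.repr (φ d))) this
  refine ⟨m, ?_⟩
  set ψ := φ - LieDerivation.inner ℂ Alg Alg m with hψ
  have h0 : ∀ y, y ≠ Gen.d → basis.repr (ψ d) y = 0 := by
    intro y hy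
    have hy' : (y.wt : ℂ) ≠ 0 := Int.cast_ne_zero.2 (mt wt_eq_zero_iff.1 hy)
    rw [hψ, LieDerivation.sub_apply, LieDerivation.inner_apply_apply, map_sub, Finsupp.sub_apply,
      repr_lie_d, hm, mul_inv_cancel_left₀ hy', sub_self]
  have hc : ψ d = basis.repr (ψ d) .d • d := by
    refine basis.ext_elem fun y => ?_
    by_cases hy : y = .d
    · subst hy; simp [d]
    · rw [h0 y hy]
      simp [d, Finsupp.single_eq_of_ne hy]
  -- compare the coefficients of `D⁺` of the one-vertex tree in the image of `⁅d, D⁺⁆ = D⁺`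
  have h1 := ψ.apply_lie_eq_add d (Dp bullet)
  rw [lie_d_Dp, size_bullet, Nat.cast_one, one_smul, hc, smul_lie, lie_d_Dp, size_bullet,
    Nat.cast_one, one_smul] at h1
  have h2 := congrArg (fun z => basis.repr z (.pos bullet)) h1
  simp only [map_add, map_smul, Finsupp.add_apply, Finsupp.smul_apply, repr_lie_d] at h2
  rw [Dp, Module.Basis.repr_self] at h2
  rw [hc]
  have h3 : basis.repr (ψ d) .d = 0 := by simpa [Gen.wt, size_bullet] using h2
  rw [h3, zero_smul]

theorem inn_eq_top : Inn ℂ Alg Alg = ⊤ := by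
  refine eq_top_iff.2 fun φ _ => ?_
  obtain ⟨m, hm⟩ := exists_sub_inner_apply_d_eq_zero φ
  set ψ := φ - LieDerivation.inner ℂ Alg Alg m with hψ
  -- the degree-one part is spanned by `D⁺` of the one-vertex tree
  have hc : ψ (Dp bullet) = basis.repr (ψ (Dp bullet)) (.pos bullet) • Dp bullet := by
    refine basis.ext_elem fun y => ?_
    by_cases hy : y.wt = (Gen.pos bullet).wt
    · have : y = .pos bullet := by
        simp only [Gen.wt, size_bullet] at hy
        cases y with
        | d => simp at hy
        | pos t => exact congrArg Gen.pos (eq_bullet_of_size_eq_one (Nat.cast_injective hy))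
        | neg t =>
          have := size_pos t
          simp only at hy
          omega
      subst this
      simp [Dp]
    · have hy' : y ≠ .pos bullet := fun h => hy (by rw [h])
      rw [Dp, repr_eq_zero_of_wt_ne hm hy]
      simp [Finsupp.single_eq_of_ne hy']
  set c := basis.repr (ψ (Dp bullet)) (.pos bullet)
  have h0 : ψ + LieDerivation.inner ℂ Alg Alg (c • d) = 0 := by
    refine eq_zero_of_apply_eq_zero ?_ ?_
    · rw [LieDerivation.add_apply, hm, LieDerivation.inner_apply_apply, lie_smul, lie_self,
        smul_zero, add_zero]
    · rw [LieDerivation.add_apply, hc, LieDerivation.inner_apply_apply, lie_smul, ← lie_skew,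
        lie_d_Dp, size_bullet, Nat.cast_one, one_smul, smul_neg, add_neg_cancel]
  refine ⟨m - c • d, ?_⟩
  rw [map_sub, eq_comm, ← sub_eq_zero, ← h0, hψ]
  abel

end Alg

/-! ### Derivations and the first cohomology -/

section Cohomology

open LieModule.Cohomology

variable (R : Type*) [CommRing R] (L : Type*) [LieRing L] [LieAlgebra R L]
  (M : Type*) [AddCommGroup M] [Module R M] [LieRingModule L M] [LieModule R L M]

/-- The `1`-cocycles are the derivations. -/
def cocycleEquivDerivation : LinearMap.ker (d₁₂ R L M) ≃ₗ[R] LieDerivation R L M where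
  toFun f :=
    { __ := f.1
      leibniz' := fun x y => by
        have h : d₁₂ R L M f.1 x y = 0 := by rw [LinearMap.mem_ker.1 f.2]; rfl
        exact (sub_eq_zero.1 h).symm }
  map_add' _ _ := rfl
  map_smul' _ _ := rfl
  invFun D := ⟨D, LinearMap.mem_ker.2 (Subtype.ext (LinearMap.ext₂ fun x y => by
    change ⁅x, D y⁆ - ⁅y, D x⁆ - D ⁅x, y⁆ = 0
    rw [D.apply_lie_eq_sub, sub_self]))⟩
  left_inv _ := rfl
  right_inv _ := rfl

/-- The first cohomology is the space of derivations modulo inner derivations. -/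
def h1EquivDerivationModInner : H1 R L M ≃ₗ[R] LieDerivation R L M ⧸ Inn R L M :=
  Submodule.Quotient.equiv _ _ (cocycleEquivDerivation R L M) (by
    ext D
    constructor
    · rintro ⟨f, ⟨m, hm⟩, rfl⟩
      exact ⟨m, LieDerivation.ext fun x => LinearMap.congr_fun hm x⟩
    · rintro ⟨m, rfl⟩
      exact ⟨(cocycleEquivDerivation R L M).symm (LieDerivation.inner R L M m), ⟨m, rfl⟩, rfl⟩)

end Cohomology

end InsElim

end

theorem mainTheorem2 :
    InsElim.Inn ℂ InsElim.Alg InsElim.Alg = ⊤ ∧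
    Nonempty (InsElim.H1 ℂ InsElim.Alg InsElim.Alg ≃ₗ[ℂ]
      (LieDerivation ℂ InsElim.Alg InsElim.Alg ⧸ InsElim.Inn ℂ InsElim.Alg InsElim.Alg)) ∧
    Subsingleton (InsElim.H1 ℂ InsElim.Alg InsElim.Alg) := by
  have e := InsElim.h1EquivDerivationModInner ℂ InsElim.Alg InsElim.Alg
  refine ⟨InsElim.Alg.inn_eq_top, ⟨e⟩, ?_⟩
  have := Submodule.Quotient.subsingleton_iff.2 InsElim.Alg.inn_eq_top
  exact e.toEquiv.subsingleton
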